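/- Let $\Omega$ be a simply connected domain (non-empty connected open set) in the Riemann sphere $\mathbb{C}\cup\{\infty\}$, and let $ds=\lambda(z)\,|dz|$ be a conformal metric on $\Omega$ with positive density $\lambda$ of class $C^2$ in local holomorphic coordinates (at $\infty$, the density is taken with respect to the coordinate $w=1/z$). Suppose that $ds$ is conformally invariant, i.e. for every conformal automorphism $f$ of $\Omega$ (holomorphic bijection $f:\Omega\to\Omega$) one has $$\lambda(f(z))\,|f'(z)|=\lambda(z)\qquad (z\in\Omega),$$ computed in local coordinates. Then the Gaussian curvature $$\kappa=-\frac{\Delta\log\lambda}{\lambda^{2}}$$ of $ds$ is constant on $\Omega$: there is a real number $\kappa_0$ such that $\kappa=\kappa_0$ at every point of $\Omega$, in each of the coordinates $z$ and $w=1/z$ that is available at that point. -/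

import Mathlib

open scoped OnePoint ContDiff Laplacian

noncomputable section

namespace RiemannSphere

/-- Labels of the two standard holomorphic coordinates on the Riemann sphere `OnePoint ℂ`:
`finite` is the coordinate `z`, and `infinite` is the coordinate `w = 1 / z`. -/
inductive Chart
  | finite
  | infinite

/-- The point of the Riemann sphere with a given value of the coordinate. -/
def Chart.param : Chart → ℂ → OnePoint ℂ
  | .finite, z => (z : OnePoint ℂ)
  | .infinite, w => if w = 0 then ∞ else ((w⁻¹ : ℂ) : OnePoint ℂ)

/-- The value of the coordinate at a point of the Riemann sphere. It is only meaningful on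
`Set.range i.param`, which is the sphere without `∞` for the coordinate `z` and
the sphere without `0` for the coordinate `w = 1 / z`; see `Chart.coord_param`. -/
def Chart.coord : Chart → OnePoint ℂ → ℂ
  | .finite, p => p.elim 0 (fun z => z)
  | .infinite, p => p.elim 0 (fun z => z⁻¹)

theorem Chart.coord_param (i : Chart) (z : ℂ) : i.coord (i.param z) = z := by
  cases i with
  | finite => rfl
  | infinite =>
    by_cases hz : z = 0
    · simp [Chart.param, Chart.coord, hz]
    · simp [Chart.param, Chart.coord, hz]

/-- The map `f` of the sphere, read in the coordinate `i` at the source and `j` at the target. -/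
def readIn (i j : Chart) (f : OnePoint ℂ → OnePoint ℂ) (z : ℂ) : ℂ :=
  j.coord (f (i.param z))

/-- The set of coordinate values at which `readIn i j f` represents `f` on `Ω`. -/
def readDomain (i j : Chart) (f : OnePoint ℂ → OnePoint ℂ) (Ω : Set (OnePoint ℂ)) : Set ℂ :=
  {z | i.param z ∈ Ω ∧ f (i.param z) ∈ Set.range j.param}

/-- `f` restricts to a conformal automorphism of the open set `Ω` of the Riemann sphere: a
bijection of `Ω` onto itself that is holomorphic (continuous, and complex differentiable
when read in the standard coordinates). Values of `f` outside `Ω` play no role. -/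
structure IsConformalAutomorphism (f : OnePoint ℂ → OnePoint ℂ) (Ω : Set (OnePoint ℂ)) :
    Prop where
  bijOn : Set.BijOn f Ω Ω
  continuousOn : ContinuousOn f Ω
  differentiableOn : ∀ i j : Chart, DifferentiableOn ℂ (readIn i j f) (readDomain i j f Ω)

/-- A conformal metric `ds = λ(z) |dz|` with positive `C²` density on an open set `Ω` of the
Riemann sphere, given by its densities in the coordinates `z` and `w = 1 / z`. As
`|dw| = |dz| / |z|²`, the two densities describe the same metric exactly
when they are related as in `compat`. Values of the densities outside `Ω` play no role. -/
structure ConformalMetric (Ω : Set (OnePoint ℂ)) where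
  density : Chart → ℂ → ℝ
  density_pos : ∀ (i : Chart) (z : ℂ), i.param z ∈ Ω → 0 < density i z
  density_contDiffOn : ∀ i : Chart, ContDiffOn ℝ 2 (density i) (i.param ⁻¹' Ω)
  compat : ∀ z : ℂ, z ≠ 0 → (z : OnePoint ℂ) ∈ Ω →
    density .finite z = density .infinite z⁻¹ / ‖z‖ ^ 2

variable {Ω : Set (OnePoint ℂ)}

/-- Every conformal automorphism `f` of `Ω` preserves the metric:
`λ(f(z)) |f'(z)| = λ(z)` on `Ω`, in all coordinates. -/
def ConformalMetric.IsConformallyInvariant (ds : ConformalMetric Ω) : Prop :=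
  ∀ f : OnePoint ℂ → OnePoint ℂ, IsConformalAutomorphism f Ω →
    ∀ i j : Chart, ∀ z ∈ readDomain i j f Ω,
      ds.density j (readIn i j f z) * ‖deriv (readIn i j f) z‖ = ds.density i z

/-- The Gaussian curvature `κ = - Δ (log λ) / λ²` of the metric, as a function of the
coordinate `i`. -/
def ConformalMetric.curvature (ds : ConformalMetric Ω) (i : Chart) (z : ℂ) : ℝ :=
  -(Δ (fun ζ : ℂ => Real.log (ds.density i ζ)) z) / ds.density i z ^ 2

/-- The Gaussian curvature takes one and the same value at all points of `Ω` (including `∞`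
if it lies in `Ω`), in whichever coordinate it is computed. -/
def ConformalMetric.HasConstantCurvature (ds : ConformalMetric Ω) : Prop :=
  ∃ κ : ℝ, ∀ (i : Chart) (z : ℂ), i.param z ∈ Ω → ds.curvature i z = κ

end RiemannSphere

end

/-! Two facts give the theorem. The curvature of an invariant metric is unchanged by every conformal
automorphism (`ConformalMetric.IsConformallyInvariant.curvature_readIn`), and the automorphisms of a
simply connected domain act transitively (`exists_isConformalAutomorphism_apply_eq`). So the
curvature has the same value at any two points.

Invariance: if λ = (λ∘F)|F'|, then log λ differs from log λ∘F by the harmonic function log |F'|.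
Since Δ(u∘F) = |F'|² (Δu)∘F, the factor |F'|² cancels against the one in λ².

Transitivity: the whole sphere is handled by translations and the inversion. Otherwise an omitted
point is moved to ∞, leaving a simply connected plane domain U. If U is the plane, translations
suffice. If not, two Riemann maps, sending p and q respectively to 0, combine to an automorphism
taking p to q. The Riemann mapping theorem is proved by Koebe's extremal argument: maximise |f'(z₀)|
among univalent maps to the disc vanishing at z₀. Montel and Hurwitz yield a maximiser, and the
square root trick shows that it is onto. -/

noncomputable section

open Set Filter Metric Topology ComplexConjugate

namespace RiemannSphere

/-! ### The Riemann mapping theorem and transitivity for plane domains -/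

section RiemannMapping

/-- The automorphism `z ↦ (z - w) / (1 - w̄ z)` of the unit disc. -/
def discShift (w z : ℂ) : ℂ := (z - w) / (1 - conj w * z)

theorem discShift_denom_ne_zero {w z : ℂ} (hw : ‖w‖ < 1) (hz : ‖z‖ < 1) :
    1 - conj w * z ≠ 0 := by
  intro h
  have h1 : ‖conj w * z‖ = 1 := by rw [← sub_eq_zero.mp h]; simp
  rw [norm_mul, RCLike.norm_conj] at h1
  nlinarith [norm_nonneg w, norm_nonneg z]

/-- Follows from |1 - w̄z|² - |z - w|² = (1 - |w|²)(1 - |z|²). -/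
theorem norm_discShift_lt_one {w z : ℂ} (hw : ‖w‖ < 1) (hz : ‖z‖ < 1) : ‖discShift w z‖ < 1 := by
  have h0 := discShift_denom_ne_zero hw hz
  rw [discShift, norm_div, div_lt_one (norm_pos_iff.mpr h0), ← sq_lt_sq₀ (norm_nonneg _)
    (norm_nonneg _)]
  have hw' : ‖w‖ ^ 2 < 1 := by nlinarith [norm_nonneg w]
  have hz' : ‖z‖ ^ 2 < 1 := by nlinarith [norm_nonneg z]
  rw [Complex.sq_norm, Complex.normSq_apply] at hw' hz' ⊢
  rw [Complex.sq_norm, Complex.normSq_apply]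
  simp only [Complex.sub_re, Complex.sub_im, Complex.mul_re, Complex.mul_im, Complex.conj_re,
    Complex.conj_im, Complex.one_re, Complex.one_im]
  nlinarith [mul_pos (sub_pos.mpr hw') (sub_pos.mpr hz')]

theorem discShift_self (w : ℂ) : discShift w w = 0 := by simp [discShift]

theorem discShift_eq_zero_iff {w z : ℂ} (hw : ‖w‖ < 1) (hz : ‖z‖ < 1) :
    discShift w z = 0 ↔ z = w := by
  rw [discShift, div_eq_zero_iff, or_iff_left (discShift_denom_ne_zero hw hz), sub_eq_zero]

theorem one_sub_conj_mul_self_ne_zero {w : ℂ} (hw : ‖w‖ < 1) : 1 - conj w * w ≠ 0 :=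
  discShift_denom_ne_zero hw hw

theorem hasDerivAt_discShift {w z : ℂ} (hw : ‖w‖ < 1) (hz : ‖z‖ < 1) :
    HasDerivAt (discShift w) ((1 - conj w * w) / (1 - conj w * z) ^ 2) z := by
  have h0 := discShift_denom_ne_zero hw hz
  have h1 : HasDerivAt (fun z : ℂ => z - w) 1 z := (hasDerivAt_id z).sub_const w
  have h2 : HasDerivAt (fun z : ℂ => 1 - conj w * z) (-(conj w)) z := by
    simpa using ((hasDerivAt_id z).const_mul (conj w)).const_sub 1
  convert! h1.div h2 h0 using 1
  ring

theorem deriv_discShift_ne_zero {w z : ℂ} (hw : ‖w‖ < 1) (hz : ‖z‖ < 1) :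
    deriv (discShift w) z ≠ 0 := by
  rw [(hasDerivAt_discShift hw hz).deriv]
  exact div_ne_zero (one_sub_conj_mul_self_ne_zero hw)
    (pow_ne_zero _ (discShift_denom_ne_zero hw hz))

theorem injOn_discShift {w : ℂ} (hw : ‖w‖ < 1) : InjOn (discShift w) (ball 0 1) := by
  intro a ha b hb h
  rw [mem_ball_zero_iff] at ha hb
  have h1 := one_sub_conj_mul_self_ne_zero hw
  rw [discShift, discShift, div_eq_div_iff (discShift_denom_ne_zero hw ha)
    (discShift_denom_ne_zero hw hb)] at h
  have : (a - b) * (1 - conj w * w) = 0 := by linear_combination h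
  exact sub_eq_zero.mp ((mul_eq_zero.mp this).resolve_right h1)

/-- A map that is univalent with nonvanishing derivative on `U`, with values in the unit disc. -/
structure IsUnivalentToDisc (f : ℂ → ℂ) (U : Set ℂ) : Prop where
  mapsTo : MapsTo f U (ball 0 1)
  injOn : InjOn f U
  deriv_ne_zero : ∀ z ∈ U, deriv f z ≠ 0

variable {U : Set ℂ} {f : ℂ → ℂ}

theorem IsUnivalentToDisc.differentiableAt (hf : IsUnivalentToDisc f U) {z : ℂ} (hz : z ∈ U) :
    DifferentiableAt ℂ f z := differentiableAt_of_deriv_ne_zero (hf.deriv_ne_zero z hz)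

theorem IsUnivalentToDisc.differentiableOn (hf : IsUnivalentToDisc f U) :
    DifferentiableOn ℂ f U := fun _ hz => (hf.differentiableAt hz).differentiableWithinAt

theorem IsUnivalentToDisc.norm_lt_one (hf : IsUnivalentToDisc f U) {z : ℂ} (hz : z ∈ U) :
    ‖f z‖ < 1 := mem_ball_zero_iff.mp (hf.mapsTo hz)

theorem IsUnivalentToDisc.discShift_comp (hf : IsUnivalentToDisc f U) {w : ℂ} (hw : ‖w‖ < 1) :
    IsUnivalentToDisc (discShift w ∘ f) U where
  mapsTo z hz := mem_ball_zero_iff.mpr (norm_discShift_lt_one hw (hf.norm_lt_one hz))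
  injOn := (injOn_discShift hw).comp hf.injOn hf.mapsTo
  deriv_ne_zero z hz := by
    rw [deriv_comp z (hasDerivAt_discShift hw (hf.norm_lt_one hz)).differentiableAt
      (hf.differentiableAt hz)]
    exact mul_ne_zero (deriv_discShift_ne_zero hw (hf.norm_lt_one hz)) (hf.deriv_ne_zero z hz)

/-- Hurwitz's theorem, local form: a locally uniform limit of nonvanishing holomorphic
functions that vanishes at a point vanishes near that point. -/
theorem eventually_eq_zero_of_tendstoLocallyUniformlyOn {ι : Type*} {φ : Filter ι} [φ.NeBot]
    {F : ι → ℂ → ℂ} {g : ℂ → ℂ} {V : Set ℂ} (hV : IsOpen V)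
    (hF : TendstoLocallyUniformlyOn F g φ V) (hd : ∀ n, DifferentiableOn ℂ (F n) V)
    (h0 : ∀ n, ∀ z ∈ V, F n z ≠ 0) {b : ℂ} (hb : b ∈ V) (hgb : g b = 0) :
    ∀ᶠ z in 𝓝 b, g z = 0 := by
  have hgd : DifferentiableOn ℂ g V := hF.differentiableOn (.of_forall hd) hV
  have hga : AnalyticAt ℂ g b := hgd.analyticAt (hV.mem_nhds hb)
  -- If b were an isolated zero, then on a small circle around it |g| ≥ m > 0. For some n this gives
  -- |F n| ≥ m/2 on the circle but |F n b| < m/2, against the maximum principle for 1/F n.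
  refine hga.eventually_eq_zero_or_eventually_ne_zero.resolve_right fun hne => ?_
  rw [eventually_nhdsWithin_iff] at hne
  obtain ⟨r, hr, hrs⟩ := Metric.nhds_basis_closedBall.mem_iff.mp
    (inter_mem hne (hV.mem_nhds hb))
  have hcV : closedBall b r ⊆ V := fun z hz => (hrs hz).2
  have hsV : sphere b r ⊆ V := sphere_subset_closedBall.trans hcV
  obtain ⟨x, hx, hxm⟩ := (isCompact_sphere b r).exists_isMinOn
    (NormedSpace.sphere_nonempty.mpr hr.le) (hgd.continuousOn.mono hsV).norm
  have hgx : g x ≠ 0 := (hrs (sphere_subset_closedBall hx)).1 (by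
    rintro rfl
    simp at hx
    exact hr.ne hx)
  set m := ‖g x‖ with hm
  have hmpos : 0 < m := norm_pos_iff.mpr hgx
  have hunif := (tendstoLocallyUniformlyOn_iff_forall_isCompact hV).mp hF _ hcV
    (isCompact_closedBall b r)
  obtain ⟨n, hn⟩ := (Metric.tendstoUniformlyOn_iff.mp hunif (m / 2) (by positivity)).exists
  have hbn : ‖F n b‖ < m / 2 := by
    have := hn b (mem_closedBall_self hr.le)
    rwa [hgb, dist_zero_left] at this
  have hinv : ‖(F n b)⁻¹‖ ≤ (m / 2)⁻¹ := by
    refine Complex.norm_le_of_forall_mem_frontier_norm_le (U := ball b r) (f := fun z => (F n z)⁻¹)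
      isBounded_ball ?_ ?_ (subset_closure (mem_ball_self hr))
    · refine DifferentiableOn.diffContOnCl ?_
      rw [closure_ball b hr.ne']
      exact ((hd n).mono hcV).inv fun z hz => h0 n z (hcV hz)
    · intro z hz
      rw [frontier_ball b hr.ne'] at hz
      have h1 : m ≤ ‖g z‖ := hxm hz
      have h2 := hn z (sphere_subset_closedBall hz)
      rw [dist_eq_norm] at h2
      have h3 : ‖g z‖ ≤ ‖g z - F n z‖ + ‖F n z‖ := by
        simpa using norm_add_le (g z - F n z) (F n z)
      rw [norm_inv]
      exact inv_anti₀ (by positivity) (by linarith)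
  rw [norm_inv] at hinv
  have := (inv_le_inv₀ (norm_pos_iff.mpr (h0 n b hb)) (by positivity)).mp hinv
  linarith

/-- Montel's theorem for sequences with values in the unit disc. -/
theorem exists_tendstoLocallyUniformlyOn_of_mapsTo_ball (hU : IsOpen U) {F : ℕ → ℂ → ℂ}
    (hd : ∀ n, DifferentiableOn ℂ (F n) U) (hm : ∀ n, MapsTo (F n) U (ball 0 1)) :
    ∃ g : ℂ → ℂ, TendstoLocallyUniformlyOn F g (hyperfilter ℕ : Filter ℕ) U := by
  -- Along an ultrafilter, compactness of the closed disc gives all pointwise limits at once, so no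
  -- diagonal subsequence is needed. Equicontinuity then upgrades them to locally uniform
  -- convergence.
  have hlim : ∀ z ∈ U, ∃ c : ℂ, Tendsto (fun n => F n z) (hyperfilter ℕ : Filter ℕ) (𝓝 c) := by
    intro z hz
    obtain ⟨c, -, hc⟩ := (isCompact_closedBall (0 : ℂ) 1).ultrafilter_le_nhds
      ((hyperfilter ℕ).map fun n => F n z) (by
        rw [Ultrafilter.coe_map, le_principal_iff]
        exact mem_map.mpr (univ_mem' fun n => ball_subset_closedBall (hm n hz)))
    exact ⟨c, hc⟩
  choose! g hg using hlim
  refine ⟨g, ?_⟩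
  have heq : ∀ K ∈ {K : Set ℂ | K ⊆ U ∧ IsCompact K}, EquicontinuousOn F K := by
    intro K hK x hx
    refine EquicontinuousAt.equicontinuousWithinAt ?_ K
    obtain ⟨r, hr, hrU⟩ := Metric.isOpen_iff.mp hU x (hK.1 hx)
    rw [Metric.equicontinuousAt_iff]
    intro ε hε
    -- Values in the unit disc differ by at most 2, so the Schwarz lemma gives the Lipschitz bound
    -- 2/r about x, uniformly in n.
    refine ⟨min r (ε * r / 2), by positivity, fun y hy n => ?_⟩
    have hyr : y ∈ ball x r := ball_subset_ball (min_le_left _ _) hy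
    have h1 := Complex.dist_le_div_mul_dist_of_mapsTo_ball (R₂ := 2) ((hd n).mono hrU) (by
      intro w hw
      have h1 := hm n (hrU hw)
      have h2 := hm n (hK.1 hx)
      rw [mem_ball_zero_iff] at h1 h2
      rw [mem_closedBall, dist_eq_norm]
      exact (norm_sub_le _ _).trans (by linarith)) hyr
    rw [dist_comm]
    refine h1.trans_lt ?_
    have h2 : dist y x < ε * r / 2 := lt_of_lt_of_le hy (min_le_right _ _)
    calc 2 / r * dist y x < 2 / r * (ε * r / 2) := by gcongr
      _ = ε := by field_simp
  have key := (EquicontinuousOn.tendsto_uniformOnFun_iff_pi' (fun K hK => hK.2) heq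
    (hyperfilter ℕ : Filter ℕ) g).mpr (by
      rw [tendsto_pi_nhds]
      rintro ⟨z, hz⟩
      obtain ⟨K, hK, hzK⟩ := mem_sUnion.mp hz
      exact hg z (hK.1 hzK))
  rw [UniformOnFun.tendsto_iff_tendstoUniformlyOn] at key
  exact (tendstoLocallyUniformlyOn_iff_forall_isCompact hU).mpr fun K hKU hK => key K ⟨hKU, hK⟩

theorem mem_nhds_image_of_deriv_ne_zero {V : Set ℂ} (hV : IsOpen V)
    (hf : DifferentiableOn ℂ f V) {z : ℂ} (hz : z ∈ V) (hd : deriv f z ≠ 0) :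
    f '' V ∈ 𝓝 (f z) := by
  have h := ((hf.analyticAt (hV.mem_nhds hz)).hasStrictDerivAt).map_nhds_eq hd
  rw [← h]
  exact image_mem_map (hV.mem_nhds hz)

/-- Hurwitz applied to the derivatives, and to `F n - F n a` on `U \ {a}`: in either case a zero of
the limit would spread over U by the identity theorem and force the derivative to vanish at z₀. -/
theorem isUnivalentToDisc_of_tendstoLocallyUniformlyOn {φ : Filter ℕ} [φ.NeBot]
    (hU : IsOpen U) (hc : IsPreconnected U) {F : ℕ → ℂ → ℂ} {g : ℂ → ℂ}
    (hF : ∀ n, IsUnivalentToDisc (F n) U) (hlim : TendstoLocallyUniformlyOn F g φ U)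
    {z₀ : ℂ} (hz₀ : z₀ ∈ U) (hg : deriv g z₀ ≠ 0) : IsUnivalentToDisc g U := by
  have hFd : ∀ n, DifferentiableOn ℂ (F n) U := fun n => (hF n).differentiableOn
  have hgd : DifferentiableOn ℂ g U := hlim.differentiableOn (.of_forall hFd) hU
  have hga : AnalyticOnNhd ℂ g U := hgd.analyticOnNhd hU
  have hderiv : ∀ z ∈ U, deriv g z ≠ 0 := by
    intro b hb hgb
    have h := eventually_eq_zero_of_tendstoLocallyUniformlyOn hU
      (hlim.deriv (.of_forall hFd) hU) (fun n => (hFd n).deriv hU)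
      (fun n => (hF n).deriv_ne_zero) hb hgb
    exact hg (hga.deriv.eqOn_zero_of_preconnected_of_eventuallyEq_zero hc hb h hz₀)
  refine ⟨fun z hz => ?_, fun a ha b hb hab => ?_, hderiv⟩
  -- Limits lie a priori only in the closed disc; openness of g puts them in its interior.
  · have hle : g '' U ⊆ closedBall 0 1 := by
      rintro _ ⟨w, hw, rfl⟩
      exact isClosed_closedBall.mem_of_tendsto (hlim.tendsto_at hw)
        (.of_forall fun n => ball_subset_closedBall ((hF n).mapsTo hw))
    rw [← interior_closedBall (0 : ℂ) one_ne_zero]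
    exact mem_interior_iff_mem_nhds.mpr
      (mem_of_superset (mem_nhds_image_of_deriv_ne_zero hU hgd hz (hderiv z hz)) hle)
  · by_contra hne
    have hV : IsOpen (U \ {a}) := hU.sdiff isClosed_singleton
    have hconst : TendstoLocallyUniformlyOn (fun n (_ : ℂ) => F n a) (fun _ => g a) φ (U \ {a}) :=
      ((hlim.tendsto_at ha).tendstoUniformlyOn_const _).tendstoLocallyUniformlyOn
    have h := eventually_eq_zero_of_tendstoLocallyUniformlyOn hV
      ((hlim.mono sdiff_subset).sub hconst)
      (fun n => ((hFd n).mono sdiff_subset).sub (differentiableOn_const _))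
      (fun n z hz h0 => hz.2 ((hF n).injOn hz.1 ha (sub_eq_zero.mp h0)))
      (b := b) ⟨hb, fun h => hne h.symm⟩ (by simp [hab])
    have heq : EqOn g (fun _ => g a) U :=
      hga.eqOn_of_preconnected_of_eventuallyEq (fun _ _ => analyticAt_const) hc hb
        (h.mono fun z hz => sub_eq_zero.mp hz)
    refine hg ?_
    rw [(heq.eventuallyEq_of_mem (hU.mem_nhds hz₀)).deriv_eq, deriv_const]

/-- The gain factor is (1 - |b|⁴) / (2|b|(1 - |b|²)) = (1 + |b|²) / (2|b|), which exceeds 1 because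
(1 - |b|)² > 0. -/
theorem norm_deriv_discShift_sqrt_gt {b d : ℂ} (hb0 : b ≠ 0) (hb1 : ‖b‖ < 1) (hd : d ≠ 0) :
    ‖d‖ < ‖(1 - conj b * b)⁻¹ * ((1 - conj (b ^ 2) * b ^ 2) * d / (2 * b))‖ := by
  have hn : ∀ z : ℂ, ‖1 - conj z * z‖ = |1 - ‖z‖ ^ 2| := by
    intro z
    rw [mul_comm, Complex.mul_conj, Complex.normSq_eq_norm_sq]
    norm_cast
  have hpos : 0 < ‖b‖ := norm_pos_iff.mpr hb0
  have hd' : 0 < ‖d‖ := norm_pos_iff.mpr hd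
  have h1 : 0 < 1 - ‖b‖ ^ 2 := by nlinarith
  have h2 : 0 < 1 - (‖b‖ ^ 2) ^ 2 := by nlinarith
  rw [norm_mul, norm_inv, norm_div, norm_mul, norm_mul, hn, hn, norm_pow, abs_of_pos h1,
    abs_of_pos h2, Complex.norm_ofNat, inv_mul_eq_div, div_div, lt_div_iff₀ (by positivity)]
  have h3 : 0 < (1 - ‖b‖) ^ 2 := by
    have : 1 - ‖b‖ ≠ 0 := by linarith
    positivity
  nlinarith [mul_pos (mul_pos hd' h1) h3]

/-- A nonvanishing holomorphic function on a simply connected domain has a holomorphic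
square root. -/
theorem exists_sq_eq_of_isSimplyConnected (hU : IsOpen U) (hs : IsSimplyConnected U) {k : ℂ → ℂ}
    (hk : DifferentiableOn ℂ k U) (hk0 : ∀ z ∈ U, k z ≠ 0) :
    ∃ h : ℂ → ℂ, (∀ z, h z ^ 2 = k z) ∧ (∀ z ∈ U, h z ≠ 0) ∧
      ∀ z ∈ U, HasDerivAt h (deriv k z / (2 * h z)) z := by
  obtain ⟨h, hhc, hh⟩ := Complex.exists_continuousOn_pow_eq hs hU hk.continuousOn
    (by rintro ⟨z, hz, h⟩; exact hk0 z hz h) two_ne_zero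
  have hh0 : ∀ z ∈ U, h z ≠ 0 := fun z hz h0 => hk0 z hz (by rw [← hh z, h0]; simp)
  refine ⟨h, hh, hh0, fun z hz => ?_⟩
  have hc : ContinuousAt h z := hhc.continuousAt (hU.mem_nhds hz)
  have hsq : HasDerivAt k (deriv k z) z := (hk.differentiableAt (hU.mem_nhds hz)).hasDerivAt
  have hne : 2 * h z ≠ 0 := mul_ne_zero two_ne_zero (hh0 z hz)
  -- The slope of k = h² is the slope of h times h y + h z, and the latter tends to 2 h z ≠ 0.
  rw [hasDerivAt_iff_tendsto_slope] at hsq ⊢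
  have hsum : Tendsto (fun y => h y + h z) (𝓝[≠] z) (𝓝 (2 * h z)) := by
    rw [two_mul]
    exact (hc.tendsto.mono_left nhdsWithin_le_nhds).add_const _
  refine (hsq.div hsum hne).congr' ?_
  filter_upwards [hsum.eventually_ne hne] with y hy
  change slope k z y / (h y + h z) = slope h z y
  rw [slope_def_field, slope_def_field, ← hh, ← hh, div_div, sq_sub_sq,
    mul_comm (y - z), mul_div_mul_left _ _ hy]

/-- A simply connected plane domain other than the plane admits a univalent map to the disc. -/
theorem exists_isUnivalentToDisc (hU : IsOpen U) (hs : IsSimplyConnected U) (hne : U ≠ univ) :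
    ∃ f, IsUnivalentToDisc f U := by
  obtain ⟨a, ha⟩ := (ne_univ_iff_exists_notMem U).mp hne
  obtain ⟨h, hh, hh0, hhd⟩ := exists_sq_eq_of_isSimplyConnected hU hs (k := fun z => z - a)
    (by fun_prop) fun z hz h0 => ha (sub_eq_zero.mp h0 ▸ hz)
  have hd1 : ∀ z, deriv (fun z => z - a) z = 1 := fun z => by simp
  have hd0 : ∀ z ∈ U, deriv h z ≠ 0 := fun z hz => by
    rw [(hhd z hz).deriv, hd1]
    exact div_ne_zero one_ne_zero (mul_ne_zero two_ne_zero (hh0 z hz))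
  have hinj : ∀ z w, h z ^ 2 = h w ^ 2 → z = w := fun z w hzw => by
    rw [hh, hh] at hzw
    exact sub_left_inj.mp hzw
  obtain ⟨x, hx⟩ := hs.nonempty
  obtain ⟨ε, hε, hball⟩ := Metric.mem_nhds_iff.mp (mem_nhds_image_of_deriv_ne_zero hU
    (fun z hz => (hhd z hz).differentiableAt.differentiableWithinAt) hx (hd0 x hx))
  -- A square root of z - a cannot take both a value and its negative on U. Since its image contains
  -- an ε-ball about h x, it avoids the ε-ball about -h x, and inverting in that ball gives a
  -- bounded map.
  have hfar : ∀ z ∈ U, ε ≤ ‖h z + h x‖ := by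
    intro z hz
    by_contra! hlt
    obtain ⟨y, hy, hyz⟩ := hball (a := -h z) (by
      rwa [mem_ball, dist_eq_norm, ← norm_neg, neg_sub, sub_neg_eq_add, add_comm])
    obtain rfl := hinj y z (by rw [hyz, neg_sq])
    exact hh0 y hy (self_eq_neg.mp hyz)
  have hne0 : ∀ z ∈ U, h z + h x ≠ 0 := fun z hz => norm_pos_iff.mp (hε.trans_le (hfar z hz))
  refine ⟨fun z => (ε / 2 : ℂ) / (h z + h x), fun z hz => ?_, fun z hz w hw hzw => ?_,
    fun z hz => ?_⟩
  · have hε' : ‖(ε / 2 : ℂ)‖ = ε / 2 := by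
      rw [norm_div, Complex.norm_real, Real.norm_of_nonneg hε.le, Complex.norm_ofNat]
    rw [mem_ball_zero_iff, norm_div, hε', div_lt_one (norm_pos_iff.mpr (hne0 z hz))]
    linarith [hfar z hz]
  · have hε' : (ε / 2 : ℂ) ≠ 0 := by simpa using hε.ne'
    simp only [div_eq_mul_inv] at hzw
    exact hinj z w (by rw [add_right_cancel (inv_injective (mul_left_cancel₀ hε' hzw))])
  · have hε' : (ε / 2 : ℂ) ≠ 0 := by simpa using hε.ne'
    have hd := (hasDerivAt_const z (ε / 2 : ℂ)).fun_div ((hhd z hz).add_const (h x)) (hne0 z hz)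
    rw [hd.deriv, ← (hhd z hz).deriv, zero_mul, zero_sub]
    exact div_ne_zero (neg_ne_zero.mpr (mul_ne_zero hε' (hd0 z hz))) (pow_ne_zero _ (hne0 z hz))

/-- The square root trick: a univalent map to the disc, not onto, can be replaced by one
with a larger derivative at its zero. -/
theorem IsUnivalentToDisc.exists_norm_deriv_lt (hU : IsOpen U) (hs : IsSimplyConnected U)
    (hf : IsUnivalentToDisc f U) {z₀ : ℂ} (hz₀ : z₀ ∈ U) (hfz : f z₀ = 0) {w : ℂ}
    (hw : ‖w‖ < 1) (hwf : w ∉ f '' U) :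
    ∃ g, IsUnivalentToDisc g U ∧ g z₀ = 0 ∧ ‖deriv f z₀‖ < ‖deriv g z₀‖ := by
  have hk := hf.discShift_comp hw
  set k := discShift w ∘ f with hkdef
  have hk0 : ∀ z ∈ U, k z ≠ 0 := fun z hz h =>
    hwf ⟨z, hz, (discShift_eq_zero_iff hw (hf.norm_lt_one hz)).mp h⟩
  obtain ⟨h, hh, hh0, hhd⟩ := exists_sq_eq_of_isSimplyConnected hU hs hk.differentiableOn hk0
  have hhm : MapsTo h U (ball 0 1) := by
    intro z hz
    have h1 := hk.norm_lt_one hz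
    rw [← hh z, norm_pow] at h1
    rw [mem_ball_zero_iff]
    nlinarith [norm_nonneg (h z)]
  have hhu : IsUnivalentToDisc h U := by
    refine ⟨hhm, fun a ha b hb hab => hk.injOn ha hb ?_, fun z hz => ?_⟩
    · rw [← hh a, ← hh b, hab]
    · rw [(hhd z hz).deriv]
      exact div_ne_zero (hk.deriv_ne_zero z hz) (mul_ne_zero two_ne_zero (hh0 z hz))
  set b := h z₀ with hb
  have hb1 : ‖b‖ < 1 := hhu.norm_lt_one hz₀
  refine ⟨discShift b ∘ h, hhu.discShift_comp hb1, discShift_self b, ?_⟩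
  have hkz : deriv k z₀ = (1 - conj w * w) * deriv f z₀ := by
    have h0 := hasDerivAt_discShift hw (hf.norm_lt_one hz₀)
    rw [hkdef, deriv_comp z₀ h0.differentiableAt (hf.differentiableAt hz₀), h0.deriv, hfz]
    simp
  have hbw : b ^ 2 = -w := by rw [hb, hh z₀, hkdef]; simp [discShift, hfz]
  have hg : deriv (discShift b ∘ h) z₀ =
      (1 - conj b * b)⁻¹ * ((1 - conj (b ^ 2) * b ^ 2) * deriv f z₀ / (2 * b)) := by
    have h0 := hasDerivAt_discShift hb1 hb1
    have h1 : 1 - conj b * b ≠ 0 := one_sub_conj_mul_self_ne_zero hb1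
    rw [deriv_comp z₀ h0.differentiableAt (hhd z₀ hz₀).differentiableAt, h0.deriv,
      (hhd z₀ hz₀).deriv, hkz, hbw, map_neg, neg_mul_neg, ← hb]
    congr 1
    field_simp
  rw [hg]
  exact norm_deriv_discShift_sqrt_gt (hh0 z₀ hz₀) hb1 (hf.deriv_ne_zero z₀ hz₀)

/-- The Riemann mapping theorem. -/
theorem exists_isUnivalentToDisc_bijOn (hU : IsOpen U) (hs : IsSimplyConnected U)
    (hne : U ≠ univ) {z₀ : ℂ} (hz₀ : z₀ ∈ U) :
    ∃ f, IsUnivalentToDisc f U ∧ f z₀ = 0 ∧ BijOn f U (ball 0 1) := by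
  obtain ⟨f₀, hf₀⟩ := exists_isUnivalentToDisc hU hs hne
  have hf₁ := hf₀.discShift_comp (hf₀.norm_lt_one hz₀)
  set S : Set ℝ := {r | ∃ f, IsUnivalentToDisc f U ∧ f z₀ = 0 ∧ ‖deriv f z₀‖ = r} with hS
  have hmem : ‖deriv (discShift (f₀ z₀) ∘ f₀) z₀‖ ∈ S := ⟨_, hf₁, discShift_self _, rfl⟩
  obtain ⟨r, hr, hrU⟩ := Metric.isOpen_iff.mp hU z₀ hz₀
  -- Schwarz lemma on a disc of radius r about z₀ contained in U.
  have hbdd : BddAbove S := by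
    refine ⟨1 / r, ?_⟩
    rintro _ ⟨f, hf, hfz, rfl⟩
    refine Complex.norm_deriv_le_div_of_mapsTo_ball (hf.differentiableOn.mono hrU) ?_ hr
    rw [hfz]
    exact fun z hz => ball_subset_closedBall (hf.mapsTo (hrU hz))
  obtain ⟨u, -, hu, huS⟩ := exists_seq_tendsto_sSup ⟨_, hmem⟩ hbdd
  choose F hFu hFz hFd using huS
  obtain ⟨g, hg⟩ := exists_tendstoLocallyUniformlyOn_of_mapsTo_ball hU
    (fun n => (hFu n).differentiableOn) (fun n => (hFu n).mapsTo)
  have hgd : ‖deriv g z₀‖ = sSup S := by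
    have h1 := ((hg.deriv (.of_forall fun n => (hFu n).differentiableOn) hU).tendsto_at hz₀).norm
    refine tendsto_nhds_unique h1 ?_
    simp only [Function.comp_apply, hFd]
    exact hu.mono_left Nat.hyperfilter_le_atTop
  have hgz : g z₀ = 0 := by
    refine tendsto_nhds_unique (hg.tendsto_at hz₀) ?_
    simp [hFz]
  -- The supremum is positive, which is what prevents the limit from being constant.
  have hgd0 : deriv g z₀ ≠ 0 := by
    rw [← norm_pos_iff, hgd]
    exact (norm_pos_iff.mpr (hf₁.deriv_ne_zero z₀ hz₀)).trans_le (le_csSup hbdd hmem)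
  have hgu := isUnivalentToDisc_of_tendstoLocallyUniformlyOn hU
    hs.isPathConnected.isConnected.isPreconnected hFu hg hz₀ hgd0
  refine ⟨g, hgu, hgz, hgu.mapsTo, hgu.injOn, fun w hw => ?_⟩
  by_contra hwg
  obtain ⟨k, hk, hkz, hlt⟩ := hgu.exists_norm_deriv_lt hU hs hz₀ hgz (mem_ball_zero_iff.mp hw) hwg
  exact absurd (le_csSup hbdd ⟨k, hk, hkz, rfl⟩) (not_le.mpr (hgd ▸ hlt))

theorem IsUnivalentToDisc.differentiableOn_invFunOn (hU : IsOpen U) (hf : IsUnivalentToDisc f U)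
    (hb : BijOn f U (ball 0 1)) : DifferentiableOn ℂ (Function.invFunOn f U) (ball 0 1) := by
  set g := Function.invFunOn f U
  have hgl : ∀ z ∈ U, g (f z) = z := hf.injOn.leftInvOn_invFunOn
  have hgr : ∀ w ∈ ball (0 : ℂ) 1, f (g w) = w := hb.surjOn.rightInvOn_invFunOn
  intro w hw
  obtain ⟨z, hz, rfl⟩ := hb.surjOn hw
  refine (HasDerivAt.differentiableAt (f' := (deriv f z)⁻¹) ?_).differentiableWithinAt
  have hgz := hgl z hz
  refine HasDerivAt.of_local_left_inverse (f := f) ?_ ?_ (hf.deriv_ne_zero z hz) ?_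
  -- Continuity of the inverse at f z: f sends open neighbourhoods of z to neighbourhoods of f z.
  · intro s hs
    rw [hgz] at hs
    rw [mem_map]
    obtain ⟨V, hVs, hVo, hzV⟩ := _root_.mem_nhds_iff.mp (inter_mem hs (hU.mem_nhds hz))
    have hVU : V ⊆ U := fun x hx => (hVs hx).2
    refine mem_of_superset (mem_nhds_image_of_deriv_ne_zero hVo (hf.differentiableOn.mono hVU) hzV
      (hf.deriv_ne_zero z hz)) ?_
    rintro _ ⟨x, hx, rfl⟩
    rw [mem_preimage, hgl x (hVU hx)]
    exact (hVs hx).1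
  · rw [hgz]
    exact (hf.differentiableAt hz).hasDerivAt
  · filter_upwards [isOpen_ball.mem_nhds hw] with y hy using hgr y hy

/-- The holomorphic automorphisms of a simply connected plane domain act transitively. -/
theorem exists_bijOn_differentiableOn_of_isSimplyConnected (hU : IsOpen U)
    (hs : IsSimplyConnected U) {p q : ℂ} (hp : p ∈ U) (hq : q ∈ U) :
    ∃ F : ℂ → ℂ, BijOn F U U ∧ DifferentiableOn ℂ F U ∧ F p = q := by
  by_cases hne : U = univ
  · subst hne
    refine ⟨fun z => z + (q - p), ?_, by fun_prop, by ring⟩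
    exact bijOn_univ.mpr (Equiv.addRight (q - p)).bijective
  obtain ⟨f, hf, hfp, hfb⟩ := exists_isUnivalentToDisc_bijOn hU hs hne hp
  obtain ⟨g, hg, hgq, hgb⟩ := exists_isUnivalentToDisc_bijOn hU hs hne hq
  have hinv : BijOn (Function.invFunOn g U) (ball 0 1) U :=
    BijOn.symm ⟨hgb.surjOn.rightInvOn_invFunOn, hgb.injOn.leftInvOn_invFunOn⟩ hgb
  refine ⟨Function.invFunOn g U ∘ f, hinv.comp hfb,
    (hg.differentiableOn_invFunOn hU hgb).comp hf.differentiableOn hf.mapsTo, ?_⟩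
  rw [Function.comp_apply, hfp, ← hgq]
  exact hgb.injOn.leftInvOn_invFunOn hq

end RiemannMapping

/-! ### Conformal behaviour of the Laplacian -/

section Laplacian

theorem laplacian_eq_fderiv_fderiv (u : ℂ → ℝ) (z : ℂ) :
    Δ u z = fderiv ℝ (fderiv ℝ u) z 1 1 + fderiv ℝ (fderiv ℝ u) z Complex.I Complex.I := by
  rw [InnerProductSpace.laplacian_eq_iteratedFDeriv_complexPlane]
  simp [iteratedFDeriv_two_apply]

/-- The Laplacian of a composition with a holomorphic function. -/
theorem laplacian_comp_of_analyticAt {u : ℂ → ℝ} {F : ℂ → ℂ} {z : ℂ}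
    (hF : AnalyticAt ℂ F z) (hu : ContDiffAt ℝ 2 u (F z)) :
    Δ (fun ζ => u (F ζ)) z = ‖deriv F z‖ ^ 2 * Δ u (F z) := by
  have hFc : ContinuousAt F z := hF.continuousAt
  have h1 : ∀ᶠ ζ in 𝓝 z, fderiv ℝ (fun ζ => u (F ζ)) ζ =
      (fderiv ℝ u (F ζ)).comp
        ((ContinuousLinearMap.toSpanSingleton ℂ (deriv F ζ)).restrictScalars ℝ) := by
    have hev : ∀ᶠ w in 𝓝 (F z), DifferentiableAt ℝ u w :=
      (hu.eventually (by simp)).mono fun w hw => hw.differentiableAt (by simp)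
    filter_upwards [hFc.eventually hev, hF.eventually_analyticAt] with ζ hζ hFζ
    exact (hζ.hasFDerivAt.comp ζ
      (hFζ.differentiableAt.hasDerivAt.hasFDerivAt.restrictScalars ℝ)).fderiv
  have hu2 : DifferentiableAt ℝ (fderiv ℝ u) (F z) :=
    (hu.fderiv_right (m := 1) (by norm_num)).differentiableAt (by simp)
  have hFd : HasFDerivAt F
      ((ContinuousLinearMap.toSpanSingleton ℂ (deriv F z)).restrictScalars ℝ) z :=
    hF.differentiableAt.hasDerivAt.hasFDerivAt.restrictScalars ℝ
  have hF2 : HasFDerivAt (deriv F)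
      ((ContinuousLinearMap.toSpanSingleton ℂ (deriv (deriv F) z)).restrictScalars ℝ) z :=
    hF.deriv.differentiableAt.hasDerivAt.hasFDerivAt.restrictScalars ℝ
  -- Second-order chain rule along v. Summed over v = 1 and v = i, the F'' terms cancel because 1² +
  -- i² = 0.
  have key : ∀ v : ℂ, fderiv ℝ (fderiv ℝ fun ζ => u (F ζ)) z v v =
      fderiv ℝ (fderiv ℝ u) (F z) (v * deriv F z) (v * deriv F z) +
        fderiv ℝ u (F z) (v * v * deriv (deriv F) z) := by
    intro v
    have hdiff : DifferentiableAt ℝ (fderiv ℝ fun ζ => u (F ζ)) z := by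
      have : ContDiffAt ℝ 2 (fun ζ => u (F ζ)) z :=
        hu.comp z ((hF.contDiffAt (n := 2)).restrict_scalars ℝ)
      exact (this.fderiv_right (m := 1) (by norm_num)).differentiableAt (by simp)
    have h2 : fderiv ℝ (fderiv ℝ fun ζ => u (F ζ)) z v v =
        fderiv ℝ (fun ζ => fderiv ℝ (fun ζ => u (F ζ)) ζ v) z v := by
      rw [(hdiff.hasFDerivAt.clm_apply (hasFDerivAt_const v z)).fderiv]
      simp
    have h3 : (fun ζ => fderiv ℝ (fun ζ => u (F ζ)) ζ v) =ᶠ[𝓝 z]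
        fun ζ => fderiv ℝ u (F ζ) (v * deriv F ζ) := by
      filter_upwards [h1] with ζ hζ
      rw [hζ]
      simp
    have h4 : HasFDerivAt (fun ζ => fderiv ℝ u (F ζ) (v * deriv F ζ)) _ z :=
      (hu2.hasFDerivAt.comp z hFd).clm_apply (hF2.const_mul v)
    rw [h2, h3.fderiv_eq, h4.fderiv]
    simp [mul_assoc, add_comm]
  rw [laplacian_eq_fderiv_fderiv, laplacian_eq_fderiv_fderiv, key, key]
  set B := fderiv ℝ (fderiv ℝ u) (F z)
  set a := deriv F z
  have ha : ∀ c d : ℝ, (c + d * Complex.I : ℂ) = c • (1 : ℂ) + d • Complex.I := by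
    intro c d; simp
  -- The vectors a and ia are an orthogonal pair of length |a|; in B(a, a) + B(ia, ia) the mixed
  -- terms cancel, leaving |a|² times the trace of B.
  have e1 : (1 : ℂ) * a = a.re • (1 : ℂ) + a.im • Complex.I := by
    rw [← ha, Complex.re_add_im, one_mul]
  have e2 : Complex.I * a = (-a.im) • (1 : ℂ) + a.re • Complex.I := by
    apply Complex.ext <;> simp
  rw [e1, e2, Complex.sq_norm, Complex.normSq_apply, Complex.I_mul_I, one_mul, one_mul, neg_one_mul,
    map_neg]
  simp only [map_add, map_smul, add_apply, smul_apply, smul_eq_mul]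
  ring

end Laplacian

/-! ### Coordinates, holomorphic maps and automorphisms of the sphere -/

section Sphere

theorem continuous_param_infinite : Continuous Chart.infinite.param := by
  rw [continuous_iff_continuousAt]
  intro w
  by_cases hw : w = 0
  · subst hw
    rw [continuousAt_iff_punctured_nhds]
    have h : Tendsto (fun w : ℂ => ((w⁻¹ : ℂ) : OnePoint ℂ)) (𝓝[≠] 0) (𝓝 ∞) := by
      refine OnePoint.tendsto_coe_infty.comp ?_
      rw [coclosedCompact_eq_cocompact, ← Metric.cobounded_eq_cocompact]
      exact tendsto_inv₀_nhdsNE_zero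
    have h0 : Chart.infinite.param 0 = (∞ : OnePoint ℂ) := by simp [Chart.param]
    rw [h0]
    refine h.congr' ?_
    filter_upwards [self_mem_nhdsWithin] with w hw
    have hw' : w ≠ 0 := hw
    simp [Chart.param, hw']
  · have h : ContinuousAt (fun w : ℂ => ((w⁻¹ : ℂ) : OnePoint ℂ)) w :=
      OnePoint.continuous_coe.continuousAt.comp (continuousAt_inv₀ hw)
    refine h.congr ?_
    filter_upwards [eventually_ne_nhds hw] with y hy
    simp [Chart.param, hy]

theorem continuous_elim_param_infinite : Continuous fun p : OnePoint ℂ =>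
    (p.elim ((0 : ℂ) : OnePoint ℂ) Chart.infinite.param : OnePoint ℂ) := by
  rw [OnePoint.continuous_iff]
  refine ⟨?_, continuous_param_infinite⟩
  have h : Tendsto (fun z : ℂ => ((z⁻¹ : ℂ) : OnePoint ℂ)) (coclosedCompact ℂ)
      (𝓝 ((0 : ℂ) : OnePoint ℂ)) := by
    refine (OnePoint.continuous_coe.tendsto 0).comp ?_
    rw [coclosedCompact_eq_cocompact, ← Metric.cobounded_eq_cocompact]
    exact tendsto_inv₀_cobounded
  refine h.congr' ?_
  rw [coclosedCompact_eq_cocompact]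
  filter_upwards [(isCompact_singleton (x := (0 : ℂ))).compl_mem_cocompact] with z hz
  have hz' : z ≠ 0 := hz
  simp [Chart.param, hz']

/-- The inversion `z ↦ 1 / z` of the Riemann sphere. -/
def inversion : OnePoint ℂ ≃ₜ OnePoint ℂ where
  toFun p := p.elim ((0 : ℂ) : OnePoint ℂ) Chart.infinite.param
  invFun p := p.elim ((0 : ℂ) : OnePoint ℂ) Chart.infinite.param
  left_inv p := by
    induction p using OnePoint.rec with
    | infty => simp [Chart.param]
    | coe z => by_cases hz : z = 0 <;> simp [Chart.param, hz]
  right_inv p := by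
    induction p using OnePoint.rec with
    | infty => simp [Chart.param]
    | coe z => by_cases hz : z = 0 <;> simp [Chart.param, hz]
  continuous_toFun := continuous_elim_param_infinite
  continuous_invFun := continuous_elim_param_infinite

theorem inversion_param_finite (z : ℂ) :
    inversion (Chart.finite.param z) = Chart.infinite.param z := rfl

theorem inversion_param_infinite (z : ℂ) :
    inversion (Chart.infinite.param z) = Chart.finite.param z := by
  rw [← inversion_param_finite]
  exact inversion.left_inv _

theorem Chart.isOpenEmbedding_param (i : Chart) : IsOpenEmbedding i.param := by
  cases i with
  | finite => exact OnePoint.isOpenEmbedding_coe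
  | infinite => exact inversion.isOpenEmbedding.comp OnePoint.isOpenEmbedding_coe

theorem Chart.param_coord (i : Chart) {p : OnePoint ℂ} (hp : p ∈ range i.param) :
    i.param (i.coord p) = p := by
  obtain ⟨z, rfl⟩ := hp
  rw [i.coord_param]

theorem exists_mem_range_param (p : OnePoint ℂ) : ∃ i : Chart, p ∈ range i.param := by
  induction p using OnePoint.rec with
  | infty => exact ⟨.infinite, 0, by simp [Chart.param]⟩
  | coe z => exact ⟨.finite, z, rfl⟩

/-- The transition maps are the identity or z ↦ 1/z; lying in both charts excludes z = 0 in the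
second case. -/
theorem differentiableAt_coord_param (i j : Chart) {z : ℂ} (hz : i.param z ∈ range j.param) :
    DifferentiableAt ℂ (fun z => j.coord (i.param z)) z := by
  have hinv : ∀ z, Chart.finite.coord (Chart.infinite.param z) = z⁻¹ := by
    intro z
    by_cases h : z = 0 <;> simp [Chart.param, Chart.coord, h]
  cases i <;> cases j
  · simp only [Chart.coord_param]
    exact differentiableAt_id
  · refine differentiableAt_inv (𝕜 := ℂ) ?_
    rintro rfl
    obtain ⟨w, hw⟩ := hz
    by_cases h : w = 0 <;> simp [Chart.param, h] at hw
  · simp only [hinv]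
    refine differentiableAt_inv (𝕜 := ℂ) ?_
    rintro rfl
    obtain ⟨w, hw⟩ := hz
    simp [Chart.param] at hw
  · simp only [Chart.coord_param]
    exact differentiableAt_id

/-- A map of the sphere is continuous at a point, and complex differentiable there when read in
some coordinates. -/
def IsDifferentiableAt (f : OnePoint ℂ → OnePoint ℂ) (p : OnePoint ℂ) : Prop :=
  ContinuousAt f p ∧ ∃ i j : Chart, p ∈ range i.param ∧ f p ∈ range j.param ∧
    DifferentiableAt ℂ (readIn i j f) (i.coord p)

variable {f g : OnePoint ℂ → OnePoint ℂ} {p : OnePoint ℂ}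

/-- Continuity of f keeps nearby values in the chart j, where the intermediate coordinate cancels.
-/
theorem IsDifferentiableAt.comp_readIn (i j k : Chart) (hfc : ContinuousAt f p)
    (hp : p ∈ range i.param) (hfp : f p ∈ range j.param)
    (hf : DifferentiableAt ℂ (readIn i j f) (i.coord p))
    (hg : DifferentiableAt ℂ (readIn j k g) (j.coord (f p))) :
    DifferentiableAt ℂ (readIn i k (g ∘ f)) (i.coord p) := by
  have hpc := i.param_coord hp
  have hc : ContinuousAt (fun z => f (i.param z)) (i.coord p) := by
    refine ContinuousAt.comp ?_ i.isOpenEmbedding_param.continuous.continuousAt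
    rwa [hpc]
  have h1 : DifferentiableAt ℂ (readIn j k g ∘ readIn i j f) (i.coord p) := by
    refine DifferentiableAt.comp _ ?_ hf
    rwa [readIn, hpc]
  refine h1.congr_of_eventuallyEq ?_
  filter_upwards [hc.eventually (j.isOpenEmbedding_param.isOpen_range.mem_nhds
    (by simpa only [hpc] using hfp))] with z hz
  simp [readIn, j.param_coord hz]

/-- Differentiability does not depend on the coordinates. -/
theorem IsDifferentiableAt.differentiableAt_readIn (hf : IsDifferentiableAt f p) {i j : Chart}
    (hi : p ∈ range i.param) (hj : f p ∈ range j.param) :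
    DifferentiableAt ℂ (readIn i j f) (i.coord p) := by
  obtain ⟨hc, i', j', hi', hj', hd⟩ := hf
  have h1 : DifferentiableAt ℂ (readIn i j' (f ∘ id)) (i.coord p) :=
    comp_readIn i i' j' continuousAt_id hi hi'
      (differentiableAt_coord_param i i' (by rwa [i.param_coord hi])) hd
  exact comp_readIn i j' j hc hi hj' h1 (g := id)
    (differentiableAt_coord_param j' j (by rwa [j'.param_coord hj']))

theorem IsDifferentiableAt.comp (hg : IsDifferentiableAt g (f p)) (hf : IsDifferentiableAt f p) :
    IsDifferentiableAt (g ∘ f) p := by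
  obtain ⟨hfc, i, j, hi, hj, hfd⟩ := hf
  obtain ⟨k, hk⟩ := exists_mem_range_param (g (f p))
  exact ⟨hg.1.comp hfc, i, k, hi, hk,
    comp_readIn i j k hfc hi hj hfd (hg.differentiableAt_readIn hj hk)⟩

theorem isConformalAutomorphism_of_isDifferentiableAt {Ω : Set (OnePoint ℂ)}
    (hb : BijOn f Ω Ω) (hd : ∀ p ∈ Ω, IsDifferentiableAt f p) : IsConformalAutomorphism f Ω where
  bijOn := hb
  continuousOn p hp := (hd p hp).1.continuousWithinAt
  differentiableOn i j z hz := by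
    have h := (hd _ hz.1).differentiableAt_readIn ⟨z, rfl⟩ hz.2
    rw [i.coord_param] at h
    exact h.differentiableWithinAt

/-- A homeomorphism of the sphere that is holomorphic together with its inverse. -/
def IsBiholomorphic (e : OnePoint ℂ ≃ₜ OnePoint ℂ) : Prop :=
  ∀ p, IsDifferentiableAt e p ∧ IsDifferentiableAt e.symm p

theorem IsBiholomorphic.symm {e : OnePoint ℂ ≃ₜ OnePoint ℂ} (he : IsBiholomorphic e) :
    IsBiholomorphic e.symm := fun p => (he p).symm

theorem IsBiholomorphic.trans {e e' : OnePoint ℂ ≃ₜ OnePoint ℂ} (he : IsBiholomorphic e)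
    (he' : IsBiholomorphic e') : IsBiholomorphic (e.trans e') := fun p =>
  ⟨(he' (e p)).1.comp (he p).1, (he (e'.symm p)).2.comp (he' p).2⟩

theorem isBiholomorphic_inversion : IsBiholomorphic inversion := by
  have h : ∀ p, IsDifferentiableAt inversion p := by
    intro p
    refine ⟨inversion.continuous.continuousAt, ?_⟩
    obtain ⟨i, z, rfl⟩ := exists_mem_range_param p
    have hdiff : ∀ {j k : Chart} (w : ℂ), (∀ w, inversion (j.param w) = k.param w) →
        DifferentiableAt ℂ (readIn j k inversion) w := by
      intro j k w hjk
      refine differentiableAt_id.congr_of_eventuallyEq (.of_forall fun w => ?_)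
      rw [readIn, hjk, Chart.coord_param]
      rfl
    cases i
    · exact ⟨.finite, .infinite, ⟨z, rfl⟩, ⟨z, (inversion_param_finite z).symm⟩,
        hdiff _ inversion_param_finite⟩
    · exact ⟨.infinite, .finite, ⟨z, rfl⟩, ⟨z, (inversion_param_infinite z).symm⟩,
        hdiff _ inversion_param_infinite⟩
  exact fun p => ⟨h p, h p⟩

/-- The translation `z ↦ z + c` of the Riemann sphere. -/
def translation (c : ℂ) : OnePoint ℂ ≃ₜ OnePoint ℂ := (Homeomorph.addRight c).onePointCongr

theorem translation_coe (c z : ℂ) : translation c (z : OnePoint ℂ) = ((z + c : ℂ) : OnePoint ℂ) :=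
  rfl

theorem translation_infty (c : ℂ) : translation c ∞ = (∞ : OnePoint ℂ) := rfl

theorem translation_symm (c : ℂ) : (translation c).symm = translation (-c) := by
  ext p
  induction p using OnePoint.rec with
  | infty => rfl
  | coe z => rfl

theorem isDifferentiableAt_translation (c : ℂ) (p : OnePoint ℂ) :
    IsDifferentiableAt (translation c) p := by
  refine ⟨(translation c).continuous.continuousAt, ?_⟩
  induction p using OnePoint.rec with
  | infty =>
    have h0 : Chart.infinite.param 0 = (∞ : OnePoint ℂ) := by simp [Chart.param]
    refine ⟨.infinite, .infinite, ⟨0, h0⟩, ⟨0, h0⟩, ?_⟩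
    -- The translation by c in the coordinate w = 1/z: 1 / (1/w + c).
    have h : DifferentiableAt ℂ (fun w : ℂ => w / (1 + c * w)) 0 :=
      differentiableAt_id.div (by fun_prop) (by simp)
    refine h.congr_of_eventuallyEq (.of_forall fun w => ?_)
    by_cases hw : w = 0
    · simp [readIn, hw, h0, translation_infty, Chart.coord]
    · simp only [readIn, Chart.param, hw, if_false, translation_coe, Chart.coord,
        OnePoint.elim_some]
      rw [← inv_div, div_eq_mul_inv, add_mul, mul_inv_cancel_right₀ hw, one_mul]
  | coe z =>
    refine ⟨.finite, .finite, ⟨z, rfl⟩, ⟨z + c, rfl⟩, ?_⟩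
    exact differentiableAt_id.add_const c

theorem isBiholomorphic_translation (c : ℂ) : IsBiholomorphic (translation c) := fun p =>
  ⟨isDifferentiableAt_translation c p, by
    rw [translation_symm]
    exact isDifferentiableAt_translation (-c) p⟩

theorem exists_isBiholomorphic_apply_eq_infty (p : OnePoint ℂ) :
    ∃ e, IsBiholomorphic e ∧ e p = (∞ : OnePoint ℂ) := by
  have hinv : inversion ((0 : ℂ) : OnePoint ℂ) = (∞ : OnePoint ℂ) := by
    rw [show ((0 : ℂ) : OnePoint ℂ) = Chart.finite.param 0 from rfl, inversion_param_finite]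
    simp [Chart.param]
  induction p using OnePoint.rec with
  | infty => exact ⟨translation 0, isBiholomorphic_translation 0, rfl⟩
  | coe z =>
    refine ⟨(translation (-z)).trans inversion,
      (isBiholomorphic_translation _).trans isBiholomorphic_inversion, ?_⟩
    rw [Homeomorph.trans_apply, translation_coe, add_neg_cancel, hinv]

/-- The conformal automorphisms of a simply connected domain of the Riemann sphere act
transitively. -/
theorem exists_isConformalAutomorphism_apply_eq {Ω : Set (OnePoint ℂ)} (hΩ : IsOpen Ω)
    (hsc : IsSimplyConnected Ω) {p q : OnePoint ℂ} (hp : p ∈ Ω) (hq : q ∈ Ω) :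
    ∃ f, IsConformalAutomorphism f Ω ∧ f p = q := by
  by_cases huniv : Ω = univ
  · subst huniv
    obtain ⟨e, he, hep⟩ := exists_isBiholomorphic_apply_eq_infty p
    obtain ⟨e', he', heq⟩ := exists_isBiholomorphic_apply_eq_infty q
    refine ⟨e.trans e'.symm, isConformalAutomorphism_of_isDifferentiableAt
      (bijOn_univ.mpr (e.trans e'.symm).bijective) fun p _ => ((he.trans he'.symm) p).1, ?_⟩
    rw [Homeomorph.trans_apply, hep, ← heq, e'.symm_apply_apply]
  obtain ⟨a, ha⟩ := (ne_univ_iff_exists_notMem Ω).mp huniv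
  obtain ⟨e, he, hea⟩ := exists_isBiholomorphic_apply_eq_infty a
  -- The plane domain corresponding to Ω once the omitted point a sits at ∞; a plane automorphism F
  -- of U is then conjugated back by e.
  set U : Set ℂ := {z | e.symm (z : OnePoint ℂ) ∈ Ω} with hU
  have hUo : IsOpen U := hΩ.preimage (e.symm.continuous.comp OnePoint.continuous_coe)
  have hrep : ∀ p ∈ Ω, ∃ z ∈ U, e p = (z : OnePoint ℂ) := by
    intro p hp
    have hne : e p ≠ (∞ : OnePoint ℂ) := by
      rw [← hea]
      exact fun h => ha (e.injective h ▸ hp)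
    obtain ⟨z, hz⟩ := OnePoint.ne_infty_iff_exists.mp hne
    exact ⟨z, by rw [hU, mem_ofPred_eq, hz, e.symm_apply_apply]; exact hp, hz.symm⟩
  have himage : ((↑) : ℂ → OnePoint ℂ) '' U = e '' Ω := by
    ext x
    constructor
    · rintro ⟨z, hz, rfl⟩
      exact ⟨_, hz, e.apply_symm_apply _⟩
    · rintro ⟨p, hp, rfl⟩
      obtain ⟨z, hz, h⟩ := hrep p hp
      exact ⟨z, hz, h.symm⟩
  have hUs : IsSimplyConnected U := by
    rw [← OnePoint.isOpenEmbedding_coe.isEmbedding.isSimplyConnected_image, himage,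
      e.isSimplyConnected_image]
    exact hsc
  obtain ⟨zp, hzp, hep⟩ := hrep p hp
  obtain ⟨zq, hzq, heq⟩ := hrep q hq
  obtain ⟨F, hFb, hFd, hFp⟩ := exists_bijOn_differentiableOn_of_isSimplyConnected hUo hUs hzp hzq
  have hcoe : BijOn ((↑) : ℂ → OnePoint ℂ) U (e '' Ω) :=
    himage ▸ OnePoint.coe_injective.injOn.bijOn_image
  have hmap : BijOn (OnePoint.map F) (e '' Ω) (e '' Ω) := by
    have h := (bijOn_comp_iff (g := OnePoint.map F) hcoe.injOn).mp (hcoe.comp hFb)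
    rwa [himage] at h
  have hmapd : ∀ z ∈ U, IsDifferentiableAt (OnePoint.map F) (z : OnePoint ℂ) := by
    intro z hz
    have hd : DifferentiableAt ℂ F z := hFd.differentiableAt (hUo.mem_nhds hz)
    exact ⟨OnePoint.continuousAt_coe.mpr
      (OnePoint.continuous_coe.continuousAt.comp hd.continuousAt),
      .finite, .finite, ⟨z, rfl⟩, ⟨F z, rfl⟩, hd⟩
  have hee : BijOn e Ω (e '' Ω) := e.injective.injOn.bijOn_image
  have hes : BijOn e.symm (e '' Ω) Ω := by
    have := e.symm.injective.injOn.bijOn_image (s := e '' Ω)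
    rwa [← image_comp, e.symm_comp_self, image_id] at this
  refine ⟨e.symm ∘ OnePoint.map F ∘ e, isConformalAutomorphism_of_isDifferentiableAt
    (hes.comp (hmap.comp hee)) fun x hx => ?_, ?_⟩
  · obtain ⟨z, hz, hez⟩ := hrep x hx
    exact ((he _).2).comp (IsDifferentiableAt.comp (hez ▸ hmapd z hz) (he x).1)
  · rw [Function.comp_apply, Function.comp_apply, hep, OnePoint.map_some, hFp, ← heq,
      e.symm_apply_apply]

/-- The curvature of a conformally invariant metric is invariant under conformal
automorphisms. -/
theorem ConformalMetric.IsConformallyInvariant.curvature_readIn {Ω : Set (OnePoint ℂ)}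
    (hΩ : IsOpen Ω) {ds : ConformalMetric Ω} (hinv : ds.IsConformallyInvariant)
    (hf : IsConformalAutomorphism f Ω) (i j : Chart) {z : ℂ} (hz : z ∈ readDomain i j f Ω) :
    ds.curvature j (readIn i j f z) = ds.curvature i z := by
  obtain ⟨F, hF⟩ : ∃ F, F = readIn i j f := ⟨_, rfl⟩
  rw [← hF]
  have hopen : IsOpen (readDomain i j f Ω) := by
    have h1 : IsOpen (Ω ∩ f ⁻¹' range j.param) :=
      hf.continuousOn.isOpen_inter_preimage hΩ j.isOpenEmbedding_param.isOpen_range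
    exact h1.preimage i.isOpenEmbedding_param.continuous
  have hFΩ : ∀ ζ ∈ readDomain i j f Ω, j.param (F ζ) ∈ Ω := by
    intro ζ hζ
    rw [hF, readIn, j.param_coord hζ.2]
    exact hf.bijOn.mapsTo hζ.1
  have hinv' : ∀ ζ ∈ readDomain i j f Ω, ds.density j (F ζ) * ‖deriv F ζ‖ = ds.density i ζ :=
    hF ▸ hinv f hf i j
  -- Positivity of the density and invariance already rule out critical points.
  have hd0 : ∀ ζ ∈ readDomain i j f Ω, deriv F ζ ≠ 0 := by
    intro ζ hζ h0
    have h1 := hinv' ζ hζ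
    rw [h0, norm_zero, mul_zero] at h1
    exact (ds.density_pos i ζ hζ.1).ne h1
  have hFa : AnalyticAt ℂ F z := hF ▸ (hf.differentiableOn i j).analyticAt (hopen.mem_nhds hz)
  have hjpos : 0 < ds.density j (F z) := ds.density_pos j _ (hFΩ z hz)
  have hlog : ContDiffAt ℝ 2 (fun w => Real.log (ds.density j w)) (F z) :=
    ((ds.density_contDiffOn j).contDiffAt
      ((hΩ.preimage j.isOpenEmbedding_param.continuous).mem_nhds (hFΩ z hz))).log hjpos.ne'
  have hharm : InnerProductSpace.HarmonicAt (fun ζ => Real.log ‖deriv F ζ‖) z :=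
    hFa.deriv.harmonicAt_log_norm (hd0 z hz)
  have hcomp : ContDiffAt ℝ 2 (fun ζ => Real.log (ds.density j (F ζ))) z :=
    hlog.comp z ((hFa.contDiffAt (n := 2)).restrict_scalars ℝ)
  have heq : (fun ζ => Real.log (ds.density i ζ)) =ᶠ[𝓝 z]
      (fun ζ => Real.log (ds.density j (F ζ))) + fun ζ => Real.log ‖deriv F ζ‖ := by
    filter_upwards [hopen.mem_nhds hz] with ζ hζ
    rw [Pi.add_apply, ← hinv' ζ hζ, Real.log_mul (ds.density_pos j _ (hFΩ ζ hζ)).ne'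
      (norm_ne_zero_iff.mpr (hd0 ζ hζ))]
  have hΔ : Δ (fun ζ => Real.log (ds.density i ζ)) z =
      ‖deriv F z‖ ^ 2 * Δ (fun w => Real.log (ds.density j w)) (F z) := by
    have h1 := (InnerProductSpace.laplacian_congr_nhds heq).eq_of_nhds
    have h2 := hcomp.laplacian_add hharm.1
    have h3 : Δ (fun ζ => Real.log ‖deriv F ζ‖) z = 0 := hharm.2.eq_of_nhds
    have h4 := laplacian_comp_of_analyticAt (u := fun w => Real.log (ds.density j w)) hFa hlog
    rw [h1, h2, h3, add_zero, h4]
  have hn : ‖deriv F z‖ ≠ 0 := norm_ne_zero_iff.mpr (hd0 z hz)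
  rw [ConformalMetric.curvature, ConformalMetric.curvature, hΔ, ← hinv' z hz]
  field_simp

end Sphere

end RiemannSphere

end

theorem mainTheorem12 (Ω : Set (OnePoint ℂ)) (hΩ : IsOpen Ω) (hsc : IsSimplyConnected Ω)
    (ds : RiemannSphere.ConformalMetric Ω) (hinv : ds.IsConformallyInvariant) :
    ds.HasConstantCurvature := by
  obtain ⟨p, hp⟩ := hsc.nonempty
  obtain ⟨i, z, rfl⟩ := RiemannSphere.exists_mem_range_param p
  refine ⟨ds.curvature i z, fun j w hw => ?_⟩
  -- An automorphism carries an arbitrary point to the base point; since invariance holds for every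
  -- pair of charts, the same step settles all coordinates.
  obtain ⟨f, hf, hfp⟩ := RiemannSphere.exists_isConformalAutomorphism_apply_eq hΩ hsc hw hp
  have h := hinv.curvature_readIn hΩ hf j i ⟨hw, by rw [hfp]; exact ⟨z, rfl⟩⟩
  rw [RiemannSphere.readIn, hfp, i.coord_param] at h
  exact h.symm
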